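/- Let $(R,\mathfrak m,k)$ be a Noetherian Cohen--Macaulay local ring of dimension $d$ with uncountable residue field $k$. A maximal Cohen--Macaulay (MCM) module is a nonzero finitely generated $R$-module $M$ for which there is an $M$-regular sequence of length $d$ in $\mathfrak m$. Assume that $R$ has finite or countable CM type, i.e. that there are at most countably many isomorphism classes of indecomposable MCM $R$-modules. Let $\Lambda$ be the set of all ideals $\operatorname{Ann}_R \operatorname{Ext}^i_R(M,N)$ with $i\ge 1$ and $M,N$ indecomposable MCM modules, and let $\Lambda'=\Lambda\setminus\{\mathfrak m,R\}$. An element of $R$ is called general if it lies in no ideal of $\Lambda'$. A system of parameters $\underline x=x_1,\dots,x_d$ (that is, $d$ elements generating an $\mathfrak m$-primary ideal) is called general if the ideal $(\underline x)$ contains a general element. Then: (a) For every general system of parameters $\underline x$ and every ideal $I$ of $R$, $$\mathfrak m\,\bigl((\underline x):((\underline x):I)\bigr)\subseteq (\underline x)+I .$$ (b) More generally, for every general system of parameters $\underline x$, every MCM module $M$ and all ideals $(\underline x)\subseteq \mathfrak a\subseteq I$ of $R$, the ideal $\mathfrak m$ annihilates $$\frac{(\underline x)M:_M(\mathfrak a:I)}{(\underline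 x)M+I\,\bigl((\underline x)M:_M\mathfrak a\bigr)} .$$ (c) If $d\ge 1$, then general systems of parameters exist. (d) The set $\Lambda'$ is a countable set of ideals properly contained in $\mathfrak m$, and for every ideal $K$ generated by a system of parameters and contained in no ideal of $\Lambda'$ (if $d=0$: for $K=0$, without any further condition), and for every ideal $I\supseteq K$, $$K:(K:I)\subseteq I:\mathfrak m .$$ -/

import Mathlib

universe u v

namespace AlmostGorenstein

open CategoryTheory IsLocalRing

/-- A maximal Cohen-Macaulay module over a local ring `R`: a nonzero finitely generated module `M`
with an `M`-regular sequence in the maximal ideal whose length is the dimension of `R`. -/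
structure IsMCM (R : Type u) [CommRing R] [IsLocalRing R]
    (M : Type v) [AddCommGroup M] [Module R M] : Prop where
  nontrivial : Nontrivial M
  finite : Module.Finite R M
  exists_isRegular : ∃ rs : List R, (∀ r ∈ rs, r ∈ maximalIdeal R) ∧
    (rs.length : WithBot ℕ∞) = ringKrullDim R ∧ RingTheory.Sequence.IsRegular M rs

/-- The indecomposable maximal Cohen-Macaulay modules. -/
def indecMCM (R : Type u) [CommRing R] [IsLocalRing R] : Set (ModuleCat.{u} R) :=
  {M | IsMCM R M ∧ Indecomposable M}

/-- At most countable (that is, finite or countably infinite) Cohen-Macaulay type: the set of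
isomorphism classes of indecomposable maximal Cohen-Macaulay modules is countable. -/
def HasCountableCMType (R : Type u) [CommRing R] [IsLocalRing R] : Prop :=
  (Quotient.mk (isIsomorphicSetoid (ModuleCat.{u} R)) '' indecMCM R).Countable

/-- The set `Λ` of the annihilators of the modules `Ext^i(M, N)`, where `i ≥ 1` and `M`, `N` are
indecomposable maximal Cohen-Macaulay modules. -/
def extAnnihilators (R : Type u) [CommRing R] [IsLocalRing R] : Set (Ideal R) :=
  {J | ∃ i : ℕ, 1 ≤ i ∧ ∃ M ∈ indecMCM R, ∃ N ∈ indecMCM R,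
    J = Module.annihilator R (Abelian.Ext M N i)}

/-- The ideals in `Λ` that a general element has to avoid: all of them, except for the maximal ideal
and for the unit ideal (the annihilator of those `Ext` modules that vanish). -/
def avoidedIdeals (R : Type u) [CommRing R] [IsLocalRing R] : Set (Ideal R) :=
  {J ∈ extAnnihilators R | J ≠ ⊤ ∧ J ≠ maximalIdeal R}

def IsGeneralElement {R : Type u} [CommRing R] [IsLocalRing R] (y : R) : Prop :=
  ∀ J ∈ avoidedIdeals R, y ∉ J

/-- A system of parameters: `d = dim R` elements that generate an ideal primary to the maximal
ideal. -/
def IsSystemOfParameters {R : Type u} [CommRing R] [IsLocalRing R] {d : ℕ} (x : Fin d → R) : Prop :=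
  ringKrullDim R = d ∧ (Ideal.span (Set.range x)).radical = maximalIdeal R

/-- A system of parameters such that the ideal it generates contains a general element. -/
def IsGeneralSOP {R : Type u} [CommRing R] [IsLocalRing R] {d : ℕ} (x : Fin d → R) : Prop :=
  IsSystemOfParameters x ∧ ∃ y ∈ Ideal.span (Set.range x), IsGeneralElement y

/-- The submodule `N :_M J` of all `u` in `M` such that `J u ⊆ N`. -/
def moduleColon {R : Type u} [CommRing R] {M : Type v} [AddCommGroup M] [Module R M]
    (N : Submodule R M) (J : Ideal R) : Submodule R M where
  carrier := {u | ∀ r ∈ J, r • u ∈ N}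
  add_mem' ha hb r hr := by
    rw [smul_add]
    exact N.add_mem (ha r hr) (hb r hr)
  zero_mem' r _ := by simp
  smul_mem' c u hu r hr := by
    rw [smul_comm]
    exact N.smul_mem c (hu r hr)

end AlmostGorenstein

open AlmostGorenstein

/-! Everything rests on one extension problem, solved in `smul_mem_of_mem_moduleColon`. Generators
f_1, ..., f_n of I define R → Y = (R/a)^n, 1 ↦ (f_j), with kernel a : I and cokernel C killed by
(x). An element m of xM : (a : I) is a map φ from R/(a : I) to M/xM. If cφ extends to ψ on Y, lifts
v_j of ψ(e_j) lie in xM : a, and cm ≡ ∑ f_j v_j modulo xM.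

Since x is M-regular, Hom(-, M/xM) is Ext^d(-, M) on modules killed by x
(`exists_ext_comp_bijective`), so the obstruction to extending cφ lies in Ext^(d+1)(C, M) = Ext^1(Z,
M), where Z is a d-th syzygy of C, hence zero or MCM. Splitting Z and M into indecomposables writes
the annihilator as an intersection of members of Λ. Each contains (x), so none is avoided and each
is 𝔪 or R (`maximalIdeal_le_annihilator_ext`). Thus every c in 𝔪 works.

General parameters exist because countably many ideals not containing 𝔪 cannot cover it when the
residue field is uncountable (`exists_mem_forall_notMem`). In dimension zero every R/J with J proper
is an indecomposable MCM module, so there are only countably many ideals. The same avoidance makes 𝔪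
principal, and then 0 : (0 : I) = I. -/

namespace AlmostGorenstein

open CategoryTheory IsLocalRing

/-! ### Dimension bounds for submodules and quotients -/

section Dimension

open RingTheory.Sequence Pointwise

variable {R : Type u} [CommRing R] [IsLocalRing R]

lemma supportDim_nonpos {M : Type v} [AddCommGroup M] [Module R M]
    (h : maximalIdeal R ≤ (Module.annihilator R M).radical) : Module.supportDim R M ≤ 0 := by
  have : Subsingleton (Module.support R M) := by
    have key : ∀ p : Module.support R M, p.1.asIdeal = maximalIdeal R := fun p ↦ by
      refine ((maximalIdeal.isMaximal R).eq_of_le p.1.2.ne_top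
        (h.trans (p.1.2.radical_le_iff.mpr ?_))).symm
      exact Module.annihilator_le_of_mem_support p.2
    exact ⟨fun p q ↦ Subtype.ext (PrimeSpectrum.ext ((key p).trans (key q).symm))⟩
  exact Order.krullDim_nonpos_of_subsingleton

variable [IsNoetherianRing R]

/-- The dimension of a nonzero submodule of `M` is at least the length of any regular sequence on
`M`. -/
lemma length_le_supportDim_of_injective {M : Type v} [AddCommGroup M] [Module R M]
    [Module.Finite R M] {rs : List R} (hmem : ∀ r ∈ rs, r ∈ maximalIdeal R)
    (hreg : IsWeaklyRegular M rs) {L : Type v} [AddCommGroup L] [Module R L] [Nontrivial L]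
    (f : L →ₗ[R] M) (hf : Function.Injective f) :
    (rs.length : WithBot ℕ∞) ≤ Module.supportDim R L := by
  induction rs generalizing M L with
  | nil =>
    have : Nonempty (Module.support R L) := Module.nonempty_support_of_nontrivial.to_subtype
    simpa [Module.supportDim] using Order.krullDim_nonneg
  | cons y rs ih =>
    obtain ⟨hy, hreg⟩ := (isWeaklyRegular_cons_iff M y rs).mp hreg
    have hLfin : Module.Finite R L := Module.Finite.of_injective f hf
    -- `S` has the annihilator, hence the dimension, of `L`, but is also closed under division by
    -- `y`. So `S / yS` embeds into `M / yM`, which need not hold for `L`.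
    let S : Submodule R M := moduleColon ⊥ (Module.annihilator R L)
    have hfS : ∀ u, f u ∈ S := fun u r hr ↦ by
      rw [← map_smul, Module.mem_annihilator.mp hr u, map_zero]
      exact Submodule.zero_mem _
    have hSnt : Nontrivial S := by
      obtain ⟨u, hu⟩ := exists_ne (0 : L)
      exact ⟨⟨f u, hfS u⟩, 0, fun h ↦ hu (hf (by simpa using congrArg Subtype.val h))⟩
    have hann : Module.annihilator R S = Module.annihilator R L := by
      refine le_antisymm (fun r hr ↦ Module.mem_annihilator.mpr fun u ↦ hf ?_)
        fun r hr ↦ Module.mem_annihilator.mpr fun u ↦ Subtype.ext (u.2 r hr)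
      simpa using congrArg Subtype.val (Module.mem_annihilator.mp hr ⟨f u, hfS u⟩)
    have hdim : Module.supportDim R S = Module.supportDim R L := by
      rw [Module.supportDim_eq_ringKrullDim_quotient_annihilator,
        Module.supportDim_eq_ringKrullDim_quotient_annihilator, hann]
    have hyS : IsSMulRegular S y := fun a b hab ↦
      Subtype.ext (hy (by simpa using congrArg Subtype.val hab))
    have hym : y ∈ maximalIdeal R := hmem y (by simp)
    have hnt : Nontrivial (QuotSMulTop y S) := nontrivial_quotSMulTop_of_mem_maximalIdeal _ hym
    have hinj : Function.Injective (QuotSMulTop.map y S.subtype) := by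
      rw [← LinearMap.ker_eq_bot, LinearMap.ker_eq_bot']
      intro q hq
      obtain ⟨s, rfl⟩ := Submodule.mkQ_surjective _ q
      have h1 : (s : M) ∈ y • (⊤ : Submodule R M) :=
        (Submodule.Quotient.mk_eq_zero _).mp hq
      obtain ⟨m, -, hm⟩ := (Submodule.mem_smul_pointwise_iff_exists _ _ _).mp h1
      have hmS : m ∈ S := fun r hr ↦ by
        have h2 : y • (r • m) = y • (0 : M) := by
          rw [smul_comm, hm, smul_zero]
          exact s.2 r hr
        exact hy h2
      refine (Submodule.Quotient.mk_eq_zero _).mpr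
        ((Submodule.mem_smul_pointwise_iff_exists _ _ _).mpr ⟨⟨m, hmS⟩, trivial, Subtype.ext hm⟩)
    have := ih (fun r hr ↦ hmem r (by simp [hr])) hreg (QuotSMulTop.map y S.subtype) hinj
    rw [← hdim, ← Module.supportDim_quotSMulTop_succ_eq_supportDim hyS hym]
    push_cast [List.length_cons]
    gcongr

lemma supportDim_le_supportDim_quotient_add_length {M : Type v} [AddCommGroup M] [Module R M]
    [Module.Finite R M] {rs : List R} (hmem : ∀ r ∈ rs, r ∈ maximalIdeal R) :
    Module.supportDim R M ≤
      Module.supportDim R (M ⧸ (Ideal.ofList rs • ⊤ : Submodule R M)) + rs.length := by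
  induction rs generalizing M with
  | nil =>
    rw [Ideal.ofList_nil, Submodule.bot_smul]
    simpa using (Module.supportDim_eq_of_equiv (Submodule.quotEquivOfEqBot ⊥ rfl)).ge
  | cons y rs ih =>
    have h1 := Module.supportDim_le_supportDim_quotSMulTop_succ (M := M) (hmem y (by simp))
    have h2 := ih (M := QuotSMulTop y M) fun r hr ↦ hmem r (by simp [hr])
    rw [← Module.supportDim_eq_of_equiv
      (Submodule.quotOfListConsSMulTopEquivQuotSMulTopInner M y rs)] at h2
    refine h1.trans ((add_le_add_left h2 1).trans (le_of_eq ?_))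
    push_cast [List.length_cons]
    rw [add_assoc]

end Dimension

/-! ### Ext and regular sequences -/

section Ext

open RingTheory.Sequence Pointwise Abelian

variable {R : Type u} [CommRing R]

/-- The long exact sequence of `Ext(X, -)` for `0 → M → M → M / r M → 0`. -/
lemma exists_ext_class_quotSMulTop {M : ModuleCat.{u} R} {r : R} (hr : IsSMulRegular M r) :
    ∃ ε : Ext (ModuleCat.of R (QuotSMulTop r M)) M 1, ∀ X : ModuleCat.{u} R,
      (∀ e : Ext X M 0, r • e = 0 → e = 0) ∧
      (∀ (i : ℕ) (e : Ext X M (i + 1)), r • e = 0 →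
        ∃ e' : Ext X (ModuleCat.of R (QuotSMulTop r M)) i, e'.comp ε rfl = e) ∧
      ∀ (i : ℕ) (e : Ext X (ModuleCat.of R (QuotSMulTop r M)) i), e.comp ε rfl = 0 →
        ∃ e' : Ext X M i, e'.comp
          (Ext.mk₀ (ModuleCat.ofHom (r • (⊤ : Submodule R M)).mkQ)) (add_zero i) = e := by
  have hS := hr.smulShortComplex_shortExact
  have hf : ∀ (X : ModuleCat.{u} R) (i : ℕ) (e : Ext X M i), r • e =
      e.comp (Ext.mk₀ (ModuleCat.smulShortComplex M r).f) (add_zero i) :=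
    fun X i e ↦ Ext.smul_eq_comp_mk₀ e r
  refine ⟨hS.extClass, fun X ↦ ⟨fun e he ↦ ?_, fun i e he ↦ ?_, fun i e he ↦ ?_⟩⟩
  · have := hS.mono_f
    exact Ext.postcomp_mk₀_injective_of_mono X (ModuleCat.smulShortComplex M r).f
      (((hf X 0 e).symm.trans he).trans (map_zero _).symm)
  · exact Ext.covariant_sequence_exact₁ X hS e ((hf X _ e).symm.trans he) rfl
  · exact Ext.covariant_sequence_exact₃ X hS e rfl he

lemma ext_subsingleton_quotSMulTop {X M : ModuleCat.{u} R} {r : R} (hr : IsSMulRegular M r) {n : ℕ}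
    (h : ∀ i < n + 1, Subsingleton (Ext X M i)) :
    ∀ i < n, Subsingleton (Ext X (ModuleCat.of R (QuotSMulTop r M)) i) := by
  intro i hi
  have := h i (by omega)
  have := h (i + 1) (by omega)
  obtain ⟨ε, hε⟩ := exists_ext_class_quotSMulTop hr
  refine subsingleton_of_forall_eq 0 fun e ↦ ?_
  obtain ⟨e', rfl⟩ := (hε X).2.2 i e (Subsingleton.elim _ _)
  rw [Subsingleton.elim e' 0, Ext.zero_comp]

lemma ext_smul_eq_zero {X M : ModuleCat.{u} R} {x : R} (hx : ∀ a : X, x • a = 0) {n : ℕ}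
    (e : Ext X M n) : x • e = 0 := by
  have h0 : x • 𝟙 X = 0 := by
    ext a
    exact hx a
  rw [← Ext.mk₀_id_comp (x • e), Ext.comp_smul, ← Ext.smul_comp, ← Ext.mk₀_smul, h0, Ext.mk₀_zero,
    Ext.zero_comp]

/-- The first element r acts as zero on Ext(X, M), so each class of positive degree comes from
Ext(X, M/rM) one degree lower, where induction applies. In degree 0, r also acts injectively. -/
lemma ext_subsingleton_of_isWeaklyRegular {X M : ModuleCat.{u} R} {rs : List R}
    (hreg : IsWeaklyRegular M rs) (hX : ∀ r ∈ rs, ∀ a : X, r • a = 0) :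
    ∀ i < rs.length, Subsingleton (Ext X M i) := by
  induction rs generalizing M with
  | nil => simp
  | cons r rs ih =>
    intro i hi
    obtain ⟨hr, hreg⟩ := (isWeaklyRegular_cons_iff M r rs).mp hreg
    obtain ⟨ε, hε⟩ := exists_ext_class_quotSMulTop hr
    refine subsingleton_of_forall_eq 0 fun e ↦ ?_
    have he : r • e = 0 := ext_smul_eq_zero (hX r (by simp)) e
    cases i with
    | zero => exact (hε X).1 e he
    | succ i =>
      obtain ⟨e', rfl⟩ := (hε X).2.1 i e he
      have := ih (M := ModuleCat.of R (QuotSMulTop r M)) hreg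
        (fun s hs ↦ hX s (by simp [hs])) i (by simpa using hi)
      rw [Subsingleton.elim e' 0, Ext.zero_comp]

/-- If `rs` is a regular sequence on `M`, then `Hom(X, M / rs M)` is naturally isomorphic to
`Ext^n(X, M)` for the modules `X` killed by `rs`, where `n` is the length of `rs`. -/
lemma exists_ext_comp_bijective {M : ModuleCat.{u} R} {rs : List R}
    (hreg : IsWeaklyRegular M rs) :
    ∃ (Q : ModuleCat.{u} R) (π : M ⟶ Q) (δ : Ext Q M rs.length), Function.Surjective π ∧
      LinearMap.ker π.hom = Ideal.ofList rs • ⊤ ∧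
      ∀ X : ModuleCat.{u} R, (∀ r ∈ rs, ∀ a : X, r • a = 0) →
        Function.Bijective fun φ : X ⟶ Q ↦ (Ext.mk₀ φ).comp δ (zero_add _) := by
  induction rs generalizing M with
  | nil =>
    refine ⟨M, 𝟙 M, Ext.mk₀ (𝟙 M), fun a ↦ ⟨a, rfl⟩, ?_, fun X _ ↦ ?_⟩
    · rw [Ideal.ofList_nil, Submodule.bot_smul]
      rfl
    · simpa using Ext.mk₀_bijective X M
  | cons r rs ih =>
    obtain ⟨hr, hreg'⟩ := (isWeaklyRegular_cons_iff M r rs).mp hreg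
    obtain ⟨Q, π, δ, hπ, hker, hbij⟩ := ih (M := ModuleCat.of R (QuotSMulTop r M)) hreg'
    obtain ⟨ε, hε⟩ := exists_ext_class_quotSMulTop hr
    refine ⟨Q, ModuleCat.ofHom (r • (⊤ : Submodule R M)).mkQ ≫ π, δ.comp ε rfl, ?_, ?_,
      fun X hX ↦ ?_⟩
    · exact hπ.comp (Submodule.mkQ_surjective _)
    · rw [ModuleCat.hom_comp, LinearMap.ker_comp, hker, ModuleCat.hom_ofHom,
        Submodule.comap_smul_top_of_surjective _ _ (Submodule.mkQ_surjective _),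
        Submodule.ker_mkQ, Ideal.ofList_cons_smul, sup_comm]
    · have hcomp : (fun φ : X ⟶ Q ↦ (Ext.mk₀ φ).comp (δ.comp ε rfl)
            (zero_add (rs.length + 1))) =
          (fun e : Ext X (ModuleCat.of R (QuotSMulTop r M)) rs.length ↦
            e.comp ε rfl) ∘ fun φ ↦ (Ext.mk₀ φ).comp δ (zero_add _) := by
        funext φ
        exact (Ext.comp_assoc _ _ _ _ _ (by simp)).symm
      change Function.Bijective fun φ : X ⟶ Q ↦ (Ext.mk₀ φ).comp (δ.comp ε rfl)
            (zero_add (rs.length + 1))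
      rw [hcomp]
      -- Composition with ε is injective because Ext(X, M) vanishes below the length of the full
      -- sequence, and surjective because `r` kills Ext(X, M).
      refine Function.Bijective.comp ⟨?_, fun e ↦ ?_⟩ (hbij X fun s hs ↦ hX s (by simp [hs]))
      · have : Subsingleton (Ext X M rs.length) :=
          ext_subsingleton_of_isWeaklyRegular hreg hX _ (by simp)
        refine (injective_iff_map_eq_zero (ε.postcomp X rfl)).mpr fun e he ↦ ?_
        obtain ⟨e', rfl⟩ := (hε X).2.2 _ e he
        rw [Subsingleton.elim e' 0, Ext.zero_comp]
      · exact (hε X).2.1 _ e (ext_smul_eq_zero (hX r (by simp)) e)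

/-- A homomorphism `φ : X → M / rs M` extends to `Y` up to the elements that annihilate
`Ext^(n+1)(Y / X, M)`, where `n` is the length of the regular sequence `rs`. -/
lemma exists_extension_smul {M : ModuleCat.{u} R} {rs : List R}
    (hreg : IsWeaklyRegular M rs) {S : ShortComplex (ModuleCat.{u} R)} (hS : S.ShortExact)
    (hY : ∀ r ∈ rs, ∀ a : S.X₂, r • a = 0) :
    ∃ (Q : ModuleCat.{u} R) (π : M ⟶ Q), Function.Surjective π ∧
      LinearMap.ker π.hom = Ideal.ofList rs • ⊤ ∧
      ∀ c ∈ Module.annihilator R (Ext S.X₃ M (1 + rs.length)), ∀ φ : S.X₁ ⟶ Q,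
        ∃ ψ : S.X₂ ⟶ Q, S.f ≫ ψ = c • φ := by
  obtain ⟨Q, π, δ, hπ, hker, hbij⟩ := exists_ext_comp_bijective hreg
  refine ⟨Q, π, hπ, hker, fun c hc φ ↦ ?_⟩
  have hX : ∀ r ∈ rs, ∀ a : S.X₁, r • a = 0 := fun r hr a ↦ by
    refine (ModuleCat.mono_iff_injective S.f).mp hS.mono_f ?_
    rw [map_smul, map_zero]
    exact hY r hr _
  -- The connecting map sends the class of φ into the Ext group killed by `c`, so `c` times this
  -- class lifts to `S.X₂`, where it is again represented by a homomorphism.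
  obtain ⟨e, he⟩ := Ext.contravariant_sequence_exact₁ hS M
    (c • (Ext.mk₀ φ).comp δ (zero_add _)) rfl (by
      rw [Ext.comp_smul]
      exact Module.mem_annihilator.mp hc _)
  obtain ⟨ψ, rfl⟩ := (hbij S.X₂ hY).2 e
  refine ⟨ψ, (hbij S.X₁ hX).1 ?_⟩
  change (Ext.mk₀ (S.f ≫ ψ)).comp δ _ = (Ext.mk₀ (c • φ)).comp δ _
  rw [Ext.mk₀_smul, Ext.smul_comp, ← he, Ext.mk₀_comp_mk₀_assoc]

end Ext

/-! ### Depth, parameters and syzygies -/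

section Depth

open RingTheory.Sequence Pointwise Abelian

lemma ofList_ofFn {A : Type*} [Semiring A] {d : ℕ} (x : Fin d → A) :
    Ideal.ofList (List.ofFn x) = Ideal.span (Set.range x) := by
  have : {r | r ∈ List.ofFn x} = Set.range x := by
    ext r
    simp [List.mem_ofFn]
  rw [Ideal.ofList, this]

variable {R : Type u} [CommRing R] [IsLocalRing R]

lemma IsMCM.ext_subsingleton {M : ModuleCat.{u} R} (hM : IsMCM R M) {d : ℕ}
    (hd : ringKrullDim R = d) :
    ∀ i < d, Subsingleton (Ext (ModuleCat.of R (R ⧸ maximalIdeal R)) M i) := by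
  obtain ⟨rs, hmem, hlen, hreg⟩ := hM.exists_isRegular
  obtain rfl : rs.length = d := by
    rw [hd] at hlen
    exact_mod_cast hlen
  refine ext_subsingleton_of_isWeaklyRegular hreg.toIsWeaklyRegular fun r hr a ↦ ?_
  obtain ⟨b, rfl⟩ := Ideal.Quotient.mk_surjective a
  exact (Submodule.Quotient.mk_eq_zero _).mpr (Ideal.mul_mem_right _ _ (hmem r hr))

lemma IsMCM.pi_ext_subsingleton (hR : IsMCM R R) {d : ℕ} (hd : ringKrullDim R = d) (n : ℕ) :
    ∀ i < d, Subsingleton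
      (Ext (ModuleCat.of R (R ⧸ maximalIdeal R)) (ModuleCat.of R (Fin n → R)) i) := by
  obtain ⟨rs, hmem, hlen, hreg⟩ := hR.exists_isRegular
  obtain rfl : rs.length = d := by
    rw [hd] at hlen
    exact_mod_cast hlen
  have := hreg.toIsWeaklyRegular.isWeaklyRegular_lTensor (M₂ := Fin n → R)
  refine ext_subsingleton_of_isWeaklyRegular
    (((TensorProduct.rid R (Fin n → R)).isWeaklyRegular_congr rs).mp this) fun r hr a ↦ ?_
  obtain ⟨b, rfl⟩ := Ideal.Quotient.mk_surjective a
  exact (Submodule.Quotient.mk_eq_zero _).mpr (Ideal.mul_mem_right _ _ (hmem r hr))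

variable [IsNoetherianRing R]

lemma exists_isRegular_of_ext_subsingleton {M : ModuleCat.{u} R} [Module.Finite R M]
    [Nontrivial M] {n : ℕ}
    (hext : ∀ i < n, Subsingleton (Ext (ModuleCat.of R (R ⧸ maximalIdeal R)) M i)) :
    ∃ rs : List R, rs.length = n ∧ (∀ r ∈ rs, r ∈ maximalIdeal R) ∧ IsRegular M rs := by
  refine ModuleCat.exists_isRegular_of_exists_subsingleton_ext (maximalIdeal R) n M ?_
    (ModuleCat.of R (R ⧸ maximalIdeal R)) ?_ hext
  · exact (Submodule.top_ne_ideal_smul_of_le_jacobson_annihilator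
      (maximalIdeal_le_jacobson _)).symm.lt_top
  · rw [Module.support_eq_zeroLocus, Ideal.annihilator_quotient]

/-- If the depth of `M` is at least `n`, then any `n` elements of the maximal ideal that generate an
ideal primary to the maximal ideal modulo the annihilator of `M` form a regular sequence. -/
lemma isWeaklyRegular_of_ext_subsingleton {M : ModuleCat.{u} R} [Module.Finite R M] {rs : List R}
    (hmem : ∀ r ∈ rs, r ∈ maximalIdeal R) {J : Ideal R} (hJ : J ≤ Module.annihilator R M)
    (hrad : maximalIdeal R ≤ (Ideal.ofList rs ⊔ J).radical)
    (hext : ∀ i < rs.length,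
      Subsingleton (Ext (ModuleCat.of R (R ⧸ maximalIdeal R)) M i)) :
    IsWeaklyRegular M rs := by
  -- `J` collects the elements already factored out of `M`.
  induction rs generalizing M J with
  | nil => exact IsWeaklyRegular.nil R M
  | cons x rs ih =>
    have hmem' : ∀ r ∈ rs, r ∈ maximalIdeal R := fun r hr ↦ hmem r (by simp [hr])
    have hsup : Ideal.ofList (x :: rs) ⊔ J = Ideal.ofList rs ⊔ (J ⊔ Ideal.span {x}) := by
      rw [Ideal.ofList_cons]
      ac_rfl
    rw [hsup] at hrad
    have hx : IsSMulRegular M x := by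
      rw [isSMulRegular_iff_right_eq_zero_of_smul]
      intro v hv
      by_contra hv0
      have : Nontrivial M := ⟨v, 0, hv0⟩
      obtain ⟨ss, hlen, hss, hreg⟩ := exists_isRegular_of_ext_subsingleton hext
      -- If x kills v ≠ 0, then Rv has dimension at least `rs.length + 1` by the depth of `M`, but
      -- at most `rs.length`, since `rs` alone cuts it down to dimension at most zero.
      let L : Submodule R M := Submodule.span R {v}
      have hL : Nontrivial L := (Submodule.nontrivial_iff_ne_bot).mpr
        (by simpa [L] using hv0)
      have h1 := length_le_supportDim_of_injective hss hreg.toIsWeaklyRegular L.subtype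
        L.injective_subtype
      have h2 := supportDim_le_supportDim_quotient_add_length (M := L) hmem'
      have hannL : J ⊔ Ideal.span {x} ≤ Module.annihilator R L := by
        refine sup_le (hJ.trans (L.subtype.annihilator_le_of_injective L.injective_subtype)) ?_
        rw [Ideal.span_singleton_le_iff_mem, Module.mem_annihilator]
        rintro ⟨w, hw⟩
        obtain ⟨c, rfl⟩ := Submodule.mem_span_singleton.mp hw
        exact Subtype.ext (by simp [smul_comm x c, hv])
      have h3 : Module.supportDim R (L ⧸ (Ideal.ofList rs • ⊤ : Submodule R L)) ≤ 0 := by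
        refine supportDim_nonpos (hrad.trans (Ideal.radical_mono (sup_le ?_ (hannL.trans
          ((Submodule.mkQ _).annihilator_le_of_surjective (Submodule.mkQ_surjective _))))))
        intro r hr
        rw [Module.mem_annihilator]
        intro q
        obtain ⟨w, rfl⟩ := Submodule.mkQ_surjective _ q
        rw [← map_smul]
        exact (Submodule.Quotient.mk_eq_zero _).mpr (Submodule.smul_mem_smul hr trivial)
      have h4 : ((rs.length + 1 : ℕ) : WithBot ℕ∞) ≤ (rs.length : ℕ) := by
        rw [hlen] at h1
        refine h1.trans (h2.trans ((add_le_add_left h3 _).trans ?_))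
        simp
      have h5 : rs.length + 1 ≤ rs.length := by exact_mod_cast h4
      omega
    refine IsWeaklyRegular.cons hx (ih (M := ModuleCat.of R (QuotSMulTop x M)) hmem'
      (J := J ⊔ Ideal.span {x}) (sup_le ?_ ?_) hrad (ext_subsingleton_quotSMulTop hx hext))
    · exact hJ.trans ((Submodule.mkQ _).annihilator_le_of_surjective (Submodule.mkQ_surjective _))
    · rw [Ideal.span_singleton_le_iff_mem, Module.mem_annihilator]
      intro q
      obtain ⟨w, rfl⟩ := Submodule.mkQ_surjective _ q
      exact (Submodule.Quotient.mk_eq_zero _).mpr (Submodule.smul_mem_pointwise_smul w x ⊤ trivial)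

lemma isMCM_of_ext_subsingleton {M : ModuleCat.{u} R} [Module.Finite R M] [Nontrivial M] {d : ℕ}
    (hd : ringKrullDim R = d)
    (hext : ∀ i < d, Subsingleton (Ext (ModuleCat.of R (R ⧸ maximalIdeal R)) M i)) :
    IsMCM R M := by
  obtain ⟨rs, hlen, hmem, hreg⟩ := exists_isRegular_of_ext_subsingleton hext
  exact ⟨inferInstance, inferInstance, rs, hmem, by rw [hlen, hd], hreg⟩

lemma IsMCM.isWeaklyRegular {M : ModuleCat.{u} R} (hM : IsMCM R M) {d : ℕ} {x : Fin d → R}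
    (hx : IsSystemOfParameters x) : IsWeaklyRegular M (List.ofFn x) := by
  have := hM.finite
  refine isWeaklyRegular_of_ext_subsingleton (J := ⊥) (fun r hr ↦ ?_) bot_le ?_ ?_
  · rw [← hx.2]
    exact Ideal.le_radical (Ideal.subset_span (by simpa [List.mem_ofFn] using hr))
  · rw [sup_bot_eq, ofList_ofFn, hx.2]
  · rw [List.length_ofFn]
    exact hM.ext_subsingleton hx.1

/-- The first syzygy in a free cover of `C`: `Ext` shifts by one, and the depth goes up by one
until it reaches the dimension of `R`. -/
lemma exists_syzygy (hR : IsMCM R R) {d : ℕ} (hd : ringKrullDim R = d) (C : ModuleCat.{u} R)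
    [Module.Finite R C] :
    ∃ Z : ModuleCat.{u} R, Module.Finite R Z ∧
      (∀ (M : ModuleCat.{u} R) (i : ℕ), 1 ≤ i →
        Module.annihilator R (Ext Z M i) = Module.annihilator R (Ext C M (1 + i))) ∧
      ∀ n < d, (∀ i < n, Subsingleton (Ext (ModuleCat.of R (R ⧸ maximalIdeal R)) C i)) →
        ∀ i < n + 1, Subsingleton (Ext (ModuleCat.of R (R ⧸ maximalIdeal R)) Z i) := by
  obtain ⟨n, f, hf⟩ := Module.Finite.exists_fin' R C
  let S : ShortComplex (ModuleCat.{u} R) :=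
    ⟨ModuleCat.ofHom (LinearMap.ker f).subtype, ModuleCat.ofHom f, by ext; simp⟩
  have hS : S.ShortExact :=
    { exact := by
        rw [ShortComplex.ShortExact.moduleCat_exact_iff_function_exact]
        exact LinearMap.exact_subtype_ker_map f
      mono_f := (ModuleCat.mono_iff_injective _).mpr (Submodule.injective_subtype _)
      epi_g := (ModuleCat.epi_iff_surjective _).mpr hf }
  have hproj : Projective S.X₂ :=
    (IsProjective.iff_projective (Fin n → R)).mp inferInstance
  refine ⟨S.X₁, inferInstanceAs (Module.Finite R (LinearMap.ker f)), fun M i hi ↦ ?_,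
    fun m hm hC i hi ↦ ?_⟩
  · obtain ⟨j, rfl⟩ := Nat.exists_eq_add_of_le' hi
    have hbij : Function.Bijective
        (Ext.bilinearCompOfLinear R S.X₃ S.X₁ M 1 (j + 1) (1 + (j + 1)) rfl hS.extClass) := by
      refine ⟨(injective_iff_map_eq_zero _).mpr fun e he ↦ ?_, fun e ↦ ?_⟩
      · obtain ⟨e', rfl⟩ := Ext.contravariant_sequence_exact₁ hS M e rfl he
        rw [Ext.eq_zero_of_projective e', Ext.comp_zero]
      · exact Ext.contravariant_sequence_exact₃ hS M e (Ext.eq_zero_of_projective _) rfl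
    exact (LinearEquiv.ofBijective _ hbij).annihilator_eq
  -- Ext^i(k, Z) lies between Ext^(i-1)(k, C) and Ext^i(k, F), with F free; `m < d` makes the latter
  -- vanish for all i ≤ m.
  · have hF := hR.pi_ext_subsingleton hd n i (by omega)
    refine subsingleton_of_forall_eq 0 fun e ↦ ?_
    cases i with
    | zero =>
      have := hS.mono_f
      refine Ext.postcomp_mk₀_injective_of_mono _ S.f ?_
      exact hF.elim _ _
    | succ i =>
      obtain ⟨e', rfl⟩ := Ext.covariant_sequence_exact₁ _ hS e (hF.elim _ _) rfl
      have := (hC i (by omega)).elim e' 0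
      rw [this, Ext.zero_comp]

lemma exists_iterated_syzygy (hR : IsMCM R R) {d : ℕ} (hd : ringKrullDim R = d)
    (C : ModuleCat.{u} R) [Module.Finite R C] (n : ℕ) (hn : n ≤ d) :
    ∃ Z : ModuleCat.{u} R, Module.Finite R Z ∧
      (∀ (M : ModuleCat.{u} R) (i : ℕ), 1 ≤ i →
        Module.annihilator R (Ext Z M i) = Module.annihilator R (Ext C M (i + n))) ∧
      ∀ i < n, Subsingleton (Ext (ModuleCat.of R (R ⧸ maximalIdeal R)) Z i) := by
  induction n with
  | zero => exact ⟨C, inferInstance, fun M i _ ↦ rfl, by simp⟩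
  | succ n ih =>
    obtain ⟨Z, hZ, hann, hext⟩ := ih (by omega)
    obtain ⟨Z', hZ', hann', hext'⟩ := exists_syzygy hR hd Z
    refine ⟨Z', hZ', fun M i hi ↦ ?_, hext' n (by omega) hext⟩
    rw [hann' M i hi, hann M _ (by omega), show 1 + i + n = i + (n + 1) by omega]

end Depth

/-! ### Annihilators of Ext under retracts and direct sums -/

section Annihilators

open Abelian Limits

variable {R : Type u} [CommRing R]

lemma annihilator_ext_le_of_retract_left {A B : ModuleCat.{u} R} {s : A ⟶ B} {p : B ⟶ A}
    (h : s ≫ p = 𝟙 A) (N : ModuleCat.{u} R) (i : ℕ) :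
    Module.annihilator R (Ext B N i) ≤ Module.annihilator R (Ext A N i) := by
  refine fun r hr ↦ Module.mem_annihilator.mpr fun e ↦ ?_
  rw [← Ext.mk₀_id_comp (r • e), ← h, ← Ext.mk₀_comp_mk₀_assoc, Ext.comp_smul,
    Module.mem_annihilator.mp hr, Ext.comp_zero]

lemma annihilator_ext_le_of_retract_right {A B : ModuleCat.{u} R} {s : A ⟶ B} {p : B ⟶ A}
    (h : s ≫ p = 𝟙 A) (N : ModuleCat.{u} R) (i : ℕ) :
    Module.annihilator R (Ext N B i) ≤ Module.annihilator R (Ext N A i) := by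
  refine fun r hr ↦ Module.mem_annihilator.mpr fun e ↦ ?_
  rw [← Ext.comp_mk₀_id (r • e), ← h, ← Ext.mk₀_comp_mk₀,
    ← Ext.comp_assoc_of_second_deg_zero, Ext.smul_comp,
    Module.mem_annihilator.mp hr, Ext.zero_comp]

lemma annihilator_ext_eq_of_iso {A A' B B' : ModuleCat.{u} R} (f : A ≅ A') (g : B ≅ B') (i : ℕ) :
    Module.annihilator R (Ext A B i) = Module.annihilator R (Ext A' B' i) :=
  le_antisymm
    ((annihilator_ext_le_of_retract_left f.inv_hom_id B i).trans
      (annihilator_ext_le_of_retract_right g.inv_hom_id A' i))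
    ((annihilator_ext_le_of_retract_left f.hom_inv_id B' i).trans
      (annihilator_ext_le_of_retract_right g.hom_inv_id A i))

lemma annihilator_ext_biprod_left (A B N : ModuleCat.{u} R) (i : ℕ) :
    Module.annihilator R (Ext (A ⊞ B) N i) =
      Module.annihilator R (Ext A N i) ⊓ Module.annihilator R (Ext B N i) := by
  refine le_antisymm (le_inf (annihilator_ext_le_of_retract_left biprod.inl_fst N i)
    (annihilator_ext_le_of_retract_left biprod.inr_snd N i)) fun r hr ↦ ?_
  refine Module.mem_annihilator.mpr fun e ↦ ?_
  rw [← Ext.mk₀_id_comp (r • e), ← biprod.total, Ext.mk₀_add, Ext.add_comp,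
    ← Ext.mk₀_comp_mk₀_assoc, ← Ext.mk₀_comp_mk₀_assoc,
    Ext.comp_smul (Ext.mk₀ biprod.inl), Ext.comp_smul (Ext.mk₀ biprod.inr),
    Module.mem_annihilator.mp hr.1, Module.mem_annihilator.mp hr.2, Ext.comp_zero, Ext.comp_zero,
    add_zero]

lemma annihilator_ext_biprod_right (A B N : ModuleCat.{u} R) (i : ℕ) :
    Module.annihilator R (Ext N (A ⊞ B) i) =
      Module.annihilator R (Ext N A i) ⊓ Module.annihilator R (Ext N B i) := by
  refine le_antisymm (le_inf (annihilator_ext_le_of_retract_right biprod.inl_fst N i)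
    (annihilator_ext_le_of_retract_right biprod.inr_snd N i)) fun r hr ↦ ?_
  refine Module.mem_annihilator.mpr fun e ↦ ?_
  rw [← Ext.comp_mk₀_id (r • e), ← biprod.total, Ext.mk₀_add, Ext.comp_add,
    ← Ext.mk₀_comp_mk₀, ← Ext.mk₀_comp_mk₀, ← Ext.comp_assoc_of_second_deg_zero,
    ← Ext.comp_assoc_of_second_deg_zero, Ext.smul_comp e (Ext.mk₀ biprod.fst),
    Ext.smul_comp e (Ext.mk₀ biprod.snd), Module.mem_annihilator.mp hr.1, Module.mem_annihilator.mp hr.2, Ext.zero_comp, Ext.zero_comp,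
    add_zero]

end Annihilators

/-! ### Decomposition into indecomposables and the extension argument -/

section Decomposition

open Abelian Limits

variable {R : Type u} [CommRing R] [IsLocalRing R]

/-- Nakayama. This rank is additive on direct sums, so it serves as the induction measure for
decompositions. -/
lemma finrank_residueField_tensor_pos {X : ModuleCat.{u} R} [Module.Finite R X]
    (hX : ¬ IsZero X) :
    0 < Module.finrank (ResidueField R) (TensorProduct R (ResidueField R) X) := by
  have : Nontrivial (TensorProduct R (ResidueField R) X) := by
    rw [← not_subsingleton_iff_nontrivial, IsLocalRing.subsingleton_tensorProduct]
    exact fun _ ↦ hX (ModuleCat.isZero_of_subsingleton X)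
  have := Module.Free.of_divisionRing (ResidueField R) (TensorProduct R (ResidueField R) X)
  exact (Module.finrank_pos_iff_of_free _ _).mpr inferInstance

lemma finrank_residueField_tensor_eq_add {M A B : ModuleCat.{u} R} [Module.Finite R A]
    [Module.Finite R B] (e : M ≅ A ⊞ B) :
    Module.finrank (ResidueField R) (TensorProduct R (ResidueField R) M) =
      Module.finrank (ResidueField R) (TensorProduct R (ResidueField R) A) +
      Module.finrank (ResidueField R) (TensorProduct R (ResidueField R) B) := by
  have := Module.Free.of_divisionRing (ResidueField R) (TensorProduct R (ResidueField R) A)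
  have := Module.Free.of_divisionRing (ResidueField R) (TensorProduct R (ResidueField R) B)
  rw [← Module.finrank_prod]
  let e₁ : M ≃ₗ[R] (A × B) := (e ≪≫ ModuleCat.biprodIsoProd A B).toLinearEquiv
  exact ((e₁.baseChange R (ResidueField R) M (A × B)).trans
    (TensorProduct.prodRight R (ResidueField R) (ResidueField R) A B)).finrank_eq

variable [IsNoetherianRing R]

lemma IsMCM.of_retract {A M : ModuleCat.{u} R} (hM : IsMCM R M) {s : A ⟶ M} {p : M ⟶ A}
    (h : s ≫ p = 𝟙 A) (hA : ¬ IsZero A) : IsMCM R A := by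
  have := hM.finite
  have hp : Function.Surjective p := fun a ↦ ⟨s a, by
    rw [← ModuleCat.comp_apply, h, ModuleCat.id_apply]⟩
  have : Module.Finite R A := Module.Finite.of_surjective p.hom hp
  have : Nontrivial A := by
    rw [← not_subsingleton_iff_nontrivial]
    exact fun _ ↦ hA (ModuleCat.isZero_of_subsingleton A)
  obtain ⟨rs, -, hlen, -⟩ := hM.exists_isRegular
  refine isMCM_of_ext_subsingleton hlen.symm fun i hi ↦ subsingleton_of_forall_eq 0 fun e ↦ ?_
  have := hM.ext_subsingleton hlen.symm i hi
  rw [← Ext.comp_mk₀_id e, ← h, ← Ext.mk₀_comp_mk₀, ← Ext.comp_assoc_of_second_deg_zero,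
    Subsingleton.elim (e.comp (Ext.mk₀ s) (add_zero i)) 0, Ext.zero_comp]

/-- Every maximal Cohen-Macaulay module is a finite direct sum of indecomposable ones, in the form
of an induction principle. -/
lemma IsMCM.decomposition_induction {P : ModuleCat.{u} R → Prop}
    (iso : ∀ A B : ModuleCat.{u} R, (A ≅ B) → P A → P B)
    (indec : ∀ A ∈ indecMCM R, P A)
    (sum : ∀ A B : ModuleCat.{u} R, P A → P B → P (A ⊞ B))
    (M : ModuleCat.{u} R) (hM : IsMCM R M) : P M := by
  induction hn : Module.finrank (ResidueField R) (TensorProduct R (ResidueField R) M)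
    using Nat.strong_induction_on generalizing M with
  | _ n ih =>
    have hMnt := hM.nontrivial
    have hMfin := hM.finite
    have hM0 : ¬ IsZero M := fun h ↦
      not_subsingleton M (ModuleCat.isZero_iff_subsingleton.mp h)
    by_cases hind : Indecomposable M
    · exact indec M ⟨hM, hind⟩
    · simp only [Indecomposable, hM0, not_false_eq_true, true_and, not_forall, not_or] at hind
      obtain ⟨A, B, e, hA, hB⟩ := hind
      have hA' : IsMCM R A := hM.of_retract (s := biprod.inl ≫ e.inv) (p := e.hom ≫ biprod.fst)
        (by simp) hA
      have hB' : IsMCM R B := hM.of_retract (s := biprod.inr ≫ e.inv) (p := e.hom ≫ biprod.snd)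
        (by simp) hB
      have hAf := hA'.finite
      have hBf := hB'.finite
      have hsum := finrank_residueField_tensor_eq_add e
      have h1 := finrank_residueField_tensor_pos hA
      have h2 := finrank_residueField_tensor_pos hB
      exact iso _ _ e.symm (sum A B (ih _ (by omega) A hA' rfl) (ih _ (by omega) B hB' rfl))

/-- The annihilator is the intersection of those for pairs of indecomposable summands. Each of these
contains K, so it is not avoided and must be 𝔪 or R. -/
lemma maximalIdeal_le_annihilator_ext {K : Ideal R} (hK : ∀ J ∈ avoidedIdeals R, ¬ K ≤ J)
    {M N : ModuleCat.{u} R} (hM : IsMCM R M) (hN : IsMCM R N) {i : ℕ} (hi : 1 ≤ i)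
    (h : K ≤ Module.annihilator R (Ext M N i)) :
    maximalIdeal R ≤ Module.annihilator R (Ext M N i) := by
  revert h
  refine hM.decomposition_induction (P := fun M ↦ K ≤ Module.annihilator R (Ext M N i) →
    maximalIdeal R ≤ Module.annihilator R (Ext M N i)) ?_ ?_ ?_
  · intro A B e hA
    rwa [← annihilator_ext_eq_of_iso e (Iso.refl N)]
  · intro A hA
    refine hN.decomposition_induction (P := fun N ↦ K ≤ Module.annihilator R (Ext A N i) →
      maximalIdeal R ≤ Module.annihilator R (Ext A N i)) ?_ ?_ ?_
    · intro B B' e hB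
      rwa [← annihilator_ext_eq_of_iso (Iso.refl A) e]
    · intro B hB h
      by_contra hcon
      refine hK _ ⟨⟨i, hi, A, hA, B, hB, rfl⟩, fun h' ↦ hcon ?_, fun h' ↦ hcon ?_⟩ h
      · rw [h']
        exact le_top
      · exact h'.ge
    · intro B B' hB hB' h
      rw [annihilator_ext_biprod_right] at h ⊢
      exact le_inf (hB (h.trans inf_le_left)) (hB' (h.trans inf_le_right))
  · intro A A' hA hA' h
    rw [annihilator_ext_biprod_left] at h ⊢
    exact le_inf (hA (h.trans inf_le_left)) (hA' (h.trans inf_le_right))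

/-- If a parameter ideal lies in no avoided ideal, then the maximal ideal annihilates
`Ext^(d+1)(C, M)` for the finitely generated modules `C` killed by that ideal. -/
lemma maximalIdeal_le_annihilator_ext_succ (hR : IsMCM R R) {d : ℕ} (hd : ringKrullDim R = d)
    {K : Ideal R} (hK : ∀ J ∈ avoidedIdeals R, ¬ K ≤ J) {M : ModuleCat.{u} R} (hM : IsMCM R M)
    {C : ModuleCat.{u} R} [Module.Finite R C] (hC : ∀ r ∈ K, ∀ c : C, r • c = 0) :
    maximalIdeal R ≤ Module.annihilator R (Ext C M (1 + d)) := by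
  obtain ⟨Z, hZ, hann, hext⟩ := exists_iterated_syzygy hR hd C d le_rfl
  have hKC : K ≤ Module.annihilator R (Ext C M (1 + d)) := fun r hr ↦
    Module.mem_annihilator.mpr fun e ↦ ext_smul_eq_zero (hC r hr) e
  rw [← hann M 1 le_rfl] at hKC ⊢
  -- The syzygy may be zero, and then it is not MCM.
  rcases subsingleton_or_nontrivial Z with h | h
  · refine fun r _ ↦ Module.mem_annihilator.mpr fun e ↦ ext_smul_eq_zero (fun a ↦ ?_) e
    exact Subsingleton.elim _ _
  · exact maximalIdeal_le_annihilator_ext hK (isMCM_of_ext_subsingleton hd hext) hM le_rfl hKC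

/-- The maximal ideal multiplies `x M : (a : I)` into `x M + I (x M : a)`. -/
lemma smul_mem_of_mem_moduleColon (hR : IsMCM R R) {d : ℕ} {x : Fin d → R}
    (hx : IsSystemOfParameters x)
    (hK : ∀ J ∈ avoidedIdeals R, ¬ Ideal.span (Set.range x) ≤ J)
    {M : Type u} [AddCommGroup M] [Module R M] (hM : IsMCM R M) {a I : Ideal R}
    (hxa : Ideal.span (Set.range x) ≤ a) {m : M}
    (hm : m ∈ moduleColon (Ideal.span (Set.range x) • (⊤ : Submodule R M)) (a.colon (I : Set R)))
    {c : R} (hc : c ∈ maximalIdeal R) :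
    c • m ∈ Ideal.span (Set.range x) • (⊤ : Submodule R M) ⊔
      I • moduleColon (Ideal.span (Set.range x) • (⊤ : Submodule R M)) a := by
  obtain ⟨n, f, hf⟩ := Submodule.fg_iff_exists_fin_generating_family.mp (IsNoetherian.noetherian I)
  let Y := Fin n → R ⧸ a
  let y : Y := fun j ↦ Ideal.Quotient.mk a (f j)
  let t : R →ₗ[R] Y := LinearMap.toSpanSingleton R Y y
  have hfI : ∀ j, f j ∈ I := fun j ↦ hf ▸ Submodule.subset_span ⟨j, rfl⟩
  have hcolon : ∀ r : R, r • y = 0 → r ∈ a.colon (I : Set R) := by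
    intro r hr
    rw [Submodule.mem_colon]
    intro z hz
    have hI : I ≤ Submodule.comap (LinearMap.lsmul R R r) a := by
      rw [← hf, Submodule.span_le]
      rintro _ ⟨j, rfl⟩
      have := congrFun hr j
      exact (Submodule.Quotient.mk_eq_zero a).mp this
    exact hI hz
  have ht : Function.Injective ((LinearMap.ker t).liftQ t le_rfl) :=
    LinearMap.ker_eq_bot.mp (Submodule.ker_liftQ_eq_bot _ _ _ le_rfl)
  let S : ShortComplex (ModuleCat.{u} R) :=
    ⟨ModuleCat.ofHom ((LinearMap.ker t).liftQ t le_rfl), ModuleCat.ofHom (LinearMap.range t).mkQ, by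
      ext
      simp only [ModuleCat.hom_comp, ModuleCat.hom_ofHom]
      exact (Submodule.Quotient.mk_eq_zero _).mpr ⟨1, rfl⟩⟩
  have hS : S.ShortExact :=
    { exact := by
        rw [ShortComplex.ShortExact.moduleCat_exact_iff_function_exact]
        change Function.Exact ((LinearMap.ker t).liftQ t le_rfl) (LinearMap.range t).mkQ
        rw [LinearMap.exact_iff, Submodule.ker_mkQ, Submodule.range_liftQ]
      mono_f := (ModuleCat.mono_iff_injective _).mpr ht
      epi_g := (ModuleCat.epi_iff_surjective _).mpr (Submodule.mkQ_surjective _) }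
  have hY : ∀ r ∈ a, ∀ b : Y, r • b = 0 := by
    intro r hr b
    funext j
    obtain ⟨b', hb'⟩ := Ideal.Quotient.mk_surjective (b j)
    rw [Pi.smul_apply, ← hb']
    exact (Submodule.Quotient.mk_eq_zero _).mpr (Ideal.mul_mem_right _ _ hr)
  have hofList : ∀ r ∈ List.ofFn x, r ∈ a := fun r hr ↦
    hxa (Ideal.subset_span (by simpa [List.mem_ofFn] using hr))
  obtain ⟨Q, π, hπ, hker, hext⟩ := exists_extension_smul
    (IsMCM.isWeaklyRegular (M := ModuleCat.of R M) hM hx) hS fun r hr ↦ hY r (hofList r hr)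
  rw [ofList_ofFn] at hker
  have hfinC : Module.Finite R S.X₃ := inferInstanceAs (Module.Finite R (Y ⧸ LinearMap.range t))
  have hcann : c ∈ Module.annihilator R (Ext S.X₃ (ModuleCat.of R M) (1 + (List.ofFn x).length)) :=
    by
    rw [List.length_ofFn]
    refine maximalIdeal_le_annihilator_ext_succ hR hx.1 hK (M := ModuleCat.of R M) hM
      (C := S.X₃) (fun r hr q ↦ ?_) hc
    obtain ⟨b, rfl⟩ := Submodule.mkQ_surjective (LinearMap.range t) q
    exact (map_smul (LinearMap.range t).mkQ r b).symm.trans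
      ((congrArg (LinearMap.range t).mkQ (hY r (hxa hr) b)).trans (map_zero _))
  -- Here the hypothesis on `m` enters: it makes r ↦ π(rm) factor through R/(a : I).
  have hle : LinearMap.ker t ≤ LinearMap.ker (π.hom ∘ₗ LinearMap.toSpanSingleton R M m) := by
    intro r hr
    have : r • m ∈ LinearMap.ker π.hom := by
      rw [hker]
      exact hm r (hcolon r hr)
    exact this
  obtain ⟨ψ, hψ⟩ := hext c hcann (ModuleCat.ofHom ((LinearMap.ker t).liftQ _ hle))
  have hψy : ψ.hom y = c • π.hom m := by
    have h1 := congrArg (fun g : S.X₁ ⟶ Q ↦ g.hom ((LinearMap.ker t).mkQ 1)) hψ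
    have h2 : ψ.hom ((1 : R) • y) = c • π.hom ((1 : R) • m) := h1
    rwa [one_smul, one_smul] at h2
  choose v hv using fun j : Fin n ↦ hπ (ψ.hom (Pi.single j 1 : Y))
  have hva : ∀ j, v j ∈ moduleColon (Ideal.span (Set.range x) • (⊤ : Submodule R M)) a := by
    intro j r hr
    rw [← hker, LinearMap.mem_ker, map_smul]
    have : π.hom (v j) = ψ.hom (Pi.single j 1 : Y) := hv j
    rw [this]
    exact (map_smul ψ.hom r (Pi.single j 1 : Y)).symm.trans
      ((congrArg ψ.hom (hY r hr _)).trans (map_zero _))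
  have hy : y = ∑ j, f j • (Pi.single j 1 : Y) := by
    funext j
    simp [y, Finset.sum_apply, Pi.single_apply, Algebra.smul_def]
  have hψy' : ψ.hom y = ∑ j, f j • π.hom (v j) := by
    have h1 : ψ.hom y = ∑ j, f j • ψ.hom (Pi.single j 1 : Y) := by
      conv_lhs => rw [hy]
      refine (map_sum ψ.hom _ _).trans (Finset.sum_congr rfl fun j _ ↦ map_smul ψ.hom _ _)
    exact h1.trans (Finset.sum_congr rfl fun j _ ↦ congrArg _ (hv j).symm)
  have hmem : c • m - ∑ j, f j • v j ∈ Ideal.span (Set.range x) • (⊤ : Submodule R M) := by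
    rw [← hker, LinearMap.mem_ker, map_sub, map_sum, map_smul, ← hψy, hψy', sub_eq_zero]
    simp only [map_smul]
  rw [← sub_add_cancel (c • m) (∑ j, f j • v j)]
  exact Submodule.add_mem_sup hmem
    (Submodule.sum_mem _ fun j _ ↦ Submodule.smul_mem_smul (hfI j) (hva j))

end Decomposition

/-! ### Countable avoidance -/

section Avoidance

variable {R : Type u} [CommRing R] [IsLocalRing R]

/-- Over a local ring with uncountable residue field, a finitely generated ideal is not covered by
countably many ideals that do not contain it. -/
lemma exists_mem_forall_notMem [Uncountable (ResidueField R)] {I : Ideal R} (hI : I.FG)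
    {S : Set (Ideal R)} (hS : S.Countable) (hSI : ∀ J ∈ S, ¬ I ≤ J) :
    ∃ y ∈ I, ∀ J ∈ S, y ∉ J := by
  obtain ⟨n, g, hg⟩ := Submodule.fg_iff_exists_fin_generating_family.mp hI
  choose σ hσ using residue_surjective (R := R)
  -- If `n` distinct parameters had values in `J`, inverting their Vandermonde matrix would put all
  -- `g j` into `J`. So each `J` excludes only finitely many `t`.
  let y : ResidueField R → R := fun t ↦ ∑ j : Fin n, σ t ^ (j : ℕ) * g j
  have hy : ∀ t, y t ∈ I := fun t ↦ Ideal.sum_mem _ fun j _ ↦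
    Ideal.mul_mem_left _ _ (hg ▸ Submodule.subset_span ⟨j, rfl⟩)
  have hfin : ∀ J ∈ S, {t | y t ∈ J}.Finite := by
    intro J hJ
    by_contra hinf
    have : Infinite {t | y t ∈ J} := Set.infinite_coe_iff.mpr hinf
    let e : Fin n → {t | y t ∈ J} := fun j ↦ Infinite.natEmbedding _ j
    have he : Function.Injective e := (Infinite.natEmbedding _).injective.comp Fin.val_injective
    let V := Matrix.vandermonde fun i ↦ σ (e i)
    have hdet : IsUnit V.det := by
      rw [Matrix.det_vandermonde, ← residue_ne_zero_iff_isUnit, map_prod]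
      refine Finset.prod_ne_zero_iff.mpr fun i _ ↦ ?_
      rw [map_prod]
      refine Finset.prod_ne_zero_iff.mpr fun j hj ↦ ?_
      rw [map_sub, hσ, hσ, sub_ne_zero]
      exact fun h ↦ (Finset.mem_Ioi.mp hj).ne' (he (Subtype.ext h))
    have hVg : V.mulVec g = fun i ↦ y (e i) := rfl
    refine hSI J hJ ?_
    rw [← hg, Submodule.span_le]
    rintro _ ⟨i, rfl⟩
    have hgi : g = V⁻¹.mulVec fun i ↦ y (e i) := by
      rw [← hVg, Matrix.mulVec_mulVec, Matrix.nonsing_inv_mul V hdet, Matrix.one_mulVec]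
    rw [hgi]
    change ∑ j, V⁻¹ i j * y (e j) ∈ J
    exact sum_mem fun j _ ↦ J.mul_mem_left _ (e j).2
  by_contra! hcon
  refine Set.not_countable_univ (α := ResidueField R) ?_
  refine (hS.biUnion fun J hJ ↦ (hfin J hJ).countable).mono fun t _ ↦ ?_
  obtain ⟨J, hJ, hyJ⟩ := hcon (y t) (hy t)
  exact Set.mem_biUnion hJ hyJ

end Avoidance

/-! ### Existence of systems of parameters -/

section Parameters

lemma exists_isSystemOfParameters (R : Type u) [CommRing R] [IsLocalRing R] [IsNoetherianRing R] :
    ∃ (d : ℕ) (x : Fin d → R), IsSystemOfParameters x := by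
  obtain ⟨s, hs, hcard⟩ := (maximalIdeal R).exists_finset_card_eq_height_of_isNoetherianRing
  refine ⟨s.card, fun i ↦ s.equivFin.symm i, ?_, ?_⟩
  · rw [← maximalIdeal_height_eq_ringKrullDim, ← hcard]
    rfl
  · have hrange : Set.range (fun i ↦ (s.equivFin.symm i : R)) = s := by
      ext r
      exact ⟨by rintro ⟨i, rfl⟩; exact (s.equivFin.symm i).2,
        fun hr ↦ ⟨s.equivFin ⟨r, hr⟩, by simp⟩⟩
    rw [hrange, Ideal.radical_eq_sInf]
    refine le_antisymm (sInf_le ⟨hs.1.2, inferInstance⟩) (le_sInf fun p hp ↦ ?_)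
    exact hs.2 ⟨hp.2, hp.1⟩ (le_maximalIdeal hp.2.ne_top)

variable {R : Type u} [CommRing R] [IsLocalRing R] [IsNoetherianRing R]

/-- Outside the minimal primes, y lowers the dimension by exactly one, so lifted parameters of R/(y)
together with y are parameters of R. -/
lemma exists_isSystemOfParameters_of_notMem_minimalPrimes {y : R} (hy : y ∈ maximalIdeal R)
    (hmin : ∀ p ∈ minimalPrimes R, y ∉ p) :
    ∃ (d : ℕ) (x : Fin d → R), IsSystemOfParameters x ∧ y ∈ Ideal.span (Set.range x) := by
  have hne : Ideal.span {y} ≠ ⊤ := fun h ↦ (maximalIdeal.isMaximal R).ne_top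
    (top_le_iff.mp (h.ge.trans ((Ideal.span_singleton_le_iff_mem _).mpr hy)))
  have : Nontrivial (R ⧸ Ideal.span {y}) := Ideal.Quotient.nontrivial_iff.mpr hne
  have hsurj : Function.Surjective (Ideal.Quotient.mk (Ideal.span {y})) :=
    Ideal.Quotient.mk_surjective
  have : IsLocalRing (R ⧸ Ideal.span {y}) := IsLocalRing.of_surjective' _ hsurj
  obtain ⟨n, x, hdim, hrad⟩ := exists_isSystemOfParameters (R ⧸ Ideal.span {y})
  choose z hz using fun i ↦ hsurj (x i)
  have hspan : Ideal.span (Set.range (Fin.cons y z : Fin (n + 1) → R)) =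
      (Ideal.span (Set.range x)).comap (Ideal.Quotient.mk (Ideal.span {y})) := by
    have hx : x = Ideal.Quotient.mk (Ideal.span {y}) ∘ z := funext fun i ↦ (hz i).symm
    rw [hx, Set.range_comp, ← Ideal.map_span, Ideal.comap_map_of_surjective' _ hsurj,
      Ideal.mk_ker, Fin.range_cons, Ideal.span_insert, sup_comm]
  refine ⟨n + 1, Fin.cons y z, ⟨?_, ?_⟩, Ideal.subset_span ⟨0, rfl⟩⟩
  · have h := Module.supportDim_quotSMulTop_succ_eq_of_notMem_minimalPrimes_of_mem_maximalIdeal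
      (M := R) (x := y) (by
        have hbot : Module.annihilator R R = ⊥ :=
          Module.annihilator_eq_bot.mpr inferInstance
        rwa [hbot]) hy
    rw [Module.supportDim_self_eq_ringKrullDim] at h
    rw [← h, Nat.cast_add, ← hdim, Nat.cast_one, ← Module.supportDim_quotient_eq_ringKrullDim]
    congr 1
    refine Module.supportDim_eq_of_equiv (Submodule.quotEquivOfEq _ _ ?_)
    rw [← Submodule.ideal_span_singleton_smul, smul_eq_mul, Ideal.mul_top]
  · rw [hspan, ← Ideal.comap_radical, hrad]
    exact eq_maximalIdeal (Ideal.comap_isMaximal_of_surjective _ hsurj)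

end Parameters

/-! ### Consequences of countable type, and dimension zero -/

section CountableType

variable {R : Type u} [CommRing R] [IsLocalRing R]

lemma countable_avoidedIdeals (htype : HasCountableCMType R) : (avoidedIdeals R).Countable := by
  refine Set.Countable.mono (s₂ := ⋃ i : ℕ,
    ⋃ p ∈ Quotient.mk (isIsomorphicSetoid (ModuleCat.{u} R)) '' indecMCM R,
    ⋃ q ∈ Quotient.mk (isIsomorphicSetoid (ModuleCat.{u} R)) '' indecMCM R,
      {Module.annihilator R (Abelian.Ext p.out q.out i)}) ?_ ?_
  · rintro _ ⟨⟨i, -, M, hM, N, hN, rfl⟩, -⟩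
    simp only [Set.mem_iUnion]
    refine ⟨i, _, ⟨M, hM, rfl⟩, _, ⟨N, hN, rfl⟩, ?_⟩
    obtain ⟨e⟩ : IsIsomorphic (Quotient.out (Quotient.mk (isIsomorphicSetoid _) M)) M :=
      Quotient.mk_out (s := isIsomorphicSetoid _) M
    obtain ⟨f⟩ : IsIsomorphic (Quotient.out (Quotient.mk (isIsomorphicSetoid _) N)) N :=
      Quotient.mk_out (s := isIsomorphicSetoid _) N
    exact annihilator_ext_eq_of_iso e.symm f.symm i
  · exact Set.countable_iUnion fun i ↦ Set.Countable.biUnion htype fun p _ ↦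
      Set.Countable.biUnion htype fun q _ ↦ Set.countable_singleton _

lemma lt_maximalIdeal_of_mem_avoidedIdeals {J : Ideal R} (hJ : J ∈ avoidedIdeals R) :
    J < maximalIdeal R :=
  lt_of_le_of_ne (le_maximalIdeal hJ.2.1) hJ.2.2

lemma exists_isGeneralSOP [IsNoetherianRing R] (htype : HasCountableCMType R)
    [Uncountable (ResidueField R)] (hdim : ringKrullDim R ≠ 0) :
    ∃ (d : ℕ) (x : Fin d → R), IsGeneralSOP x := by
  -- The minimal primes are avoided as well, so that `y` is part of a system of parameters; positive
  -- dimension keeps 𝔪 out of them.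
  obtain ⟨y, hym, hy⟩ := exists_mem_forall_notMem (IsNoetherian.noetherian (maximalIdeal R))
    ((countable_avoidedIdeals htype).union
      (minimalPrimes.finite_of_isNoetherianRing R).countable) (by
    rintro J (hJ | hJ) hle
    · exact (lt_maximalIdeal_of_mem_avoidedIdeals hJ).not_ge hle
    · have hJm : J = maximalIdeal R := (maximalIdeal.isMaximal R).eq_of_le hJ.1.1.ne_top hle |>.symm
      refine hdim (ringKrullDimZero_iff_ringKrullDim_eq_zero.mp
        (Ring.krullDimLE_zero_iff_forall_minimalPrimes_isMaximal.mpr fun p hp ↦ ?_))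
      have hpm : p = maximalIdeal R := le_antisymm (le_maximalIdeal hp.1.1.ne_top)
        (hJm ▸ hJ.2 hp.1 (hJm ▸ le_maximalIdeal hp.1.1.ne_top))
      exact hpm ▸ maximalIdeal.isMaximal R)
  obtain ⟨d, x, hx, hyx⟩ := exists_isSystemOfParameters_of_notMem_minimalPrimes hym
    fun p hp ↦ hy p (Or.inr hp)
  exact ⟨d, x, hx, y, hyx, fun J hJ ↦ hy J (Or.inl hJ)⟩

/-- The empty sequence witnesses MCM. A cyclic module has rank at most one over the residue field,
too little for two nonzero summands. -/
lemma quotient_mem_indecMCM (hdim : ringKrullDim R = 0) {J : Ideal R} (hJ : J ≠ ⊤) :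
    ModuleCat.of R (R ⧸ J) ∈ indecMCM R := by
  have hnt : Nontrivial (R ⧸ J) := Ideal.Quotient.nontrivial_iff.mpr hJ
  refine ⟨⟨hnt, inferInstanceAs (Module.Finite R (R ⧸ J)), [], by simp, by simp [hdim],
    RingTheory.Sequence.IsRegular.nil R (R ⧸ J)⟩, fun h ↦ ?_, fun A B e ↦ ?_⟩
  · exact not_subsingleton (R ⧸ J) (ModuleCat.isZero_iff_subsingleton.mp h)
  · have hA : Module.Finite R A := Module.Finite.of_surjective
      ((e.hom ≫ Limits.biprod.fst).hom ∘ₗ J.mkQ)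
      (((ModuleCat.epi_iff_surjective (e.hom ≫ Limits.biprod.fst)).mp inferInstance).comp
        J.mkQ_surjective)
    have hB : Module.Finite R B := Module.Finite.of_surjective
      ((e.hom ≫ Limits.biprod.snd).hom ∘ₗ J.mkQ)
      (((ModuleCat.epi_iff_surjective (e.hom ≫ Limits.biprod.snd)).mp inferInstance).comp
        J.mkQ_surjective)
    have hsum := finrank_residueField_tensor_eq_add e
    have hle : Module.finrank (ResidueField R) (TensorProduct R (ResidueField R) (R ⧸ J)) ≤ 1 := by
      have := LinearMap.finrank_le_finrank_of_surjective
        (f := J.mkQ.baseChange (ResidueField R))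
        (LinearMap.lTensor_surjective _ (Submodule.mkQ_surjective J))
      rwa [Module.finrank_baseChange (M' := R), Module.finrank_self] at this
    by_contra! hcon
    have h1 := finrank_residueField_tensor_pos hcon.1
    have h2 := finrank_residueField_tensor_pos hcon.2
    have h3 : Module.finrank (ResidueField R) (TensorProduct R (ResidueField R) A) +
      Module.finrank (ResidueField R) (TensorProduct R (ResidueField R) B) ≤ 1 := hsum ▸ hle
    omega

/-- In dimension zero every proper ideal is the annihilator of an indecomposable maximal
Cohen-Macaulay module. -/
lemma countable_ideals (htype : HasCountableCMType R) (hdim : ringKrullDim R = 0) :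
    {J : Ideal R | J ≠ ⊤}.Countable := by
  refine Set.MapsTo.countable_of_injOn
    (f := fun J ↦ Quotient.mk (isIsomorphicSetoid (ModuleCat.{u} R)) (ModuleCat.of R (R ⧸ J)))
    (fun J hJ ↦ Set.mem_image_of_mem _ (quotient_mem_indecMCM hdim hJ)) (fun J _ J' _ h ↦ ?_) htype
  obtain ⟨e⟩ : IsIsomorphic (ModuleCat.of R (R ⧸ J)) (ModuleCat.of R (R ⧸ J')) :=
    Quotient.exact (s := isIsomorphicSetoid _) h
  have e' : (R ⧸ J) ≃ₗ[R] (R ⧸ J') := e.toLinearEquiv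
  simpa [Ideal.annihilator_quotient] using e'.annihilator_eq

/-- An element of 𝔪 outside all the countably many ideals strictly below 𝔪 must generate 𝔪. -/
lemma exists_maximalIdeal_eq_span_singleton [IsNoetherianRing R] [Uncountable (ResidueField R)]
    (htype : HasCountableCMType R) (hdim : ringKrullDim R = 0) :
    ∃ t : R, maximalIdeal R = Ideal.span {t} := by
  obtain ⟨t, ht, hne⟩ := exists_mem_forall_notMem (IsNoetherian.noetherian (maximalIdeal R))
    (S := {J | J < maximalIdeal R})
    ((countable_ideals htype hdim).mono fun J (hJ : J < _) ↦ (hJ.trans_le le_top).ne)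
    fun J hJ ↦ hJ.not_ge
  refine ⟨t, ?_⟩
  by_contra hcon
  refine hne (Ideal.span {t}) (lt_of_le_of_ne ?_ (Ne.symm hcon)) (Ideal.mem_span_singleton_self t)
  rwa [Ideal.span_singleton_le_iff_mem]

/-- Every ideal of an Artinian local principal ideal ring is a double annihilator. -/
lemma bot_colon_bot_colon_le {t : R} (ht : maximalIdeal R = Ideal.span {t}) (hnil : IsNilpotent t)
    (I : Ideal R) :
    (⊥ : Ideal R).colon ((⊥ : Ideal R).colon (I : Set R) : Set R) ≤ I := by
  classical
  let n := Nat.find hnil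
  have hn : t ^ n = 0 := Nat.find_spec hnil
  have hn' : ∀ j, t ^ j = 0 → n ≤ j := fun j ↦ Nat.find_min' hnil
  have key : ∀ z : R, z ≠ 0 → ∃ (j : ℕ) (w : R), IsUnit w ∧ z = t ^ j * w := by
    intro z hz
    by_contra! hcon
    have hdvd : ∀ j, t ^ j ∣ z := by
      intro j
      induction j with
      | zero => simp
      | succ j ih =>
        obtain ⟨w, hw⟩ := ih
        have hwm : w ∈ maximalIdeal R := (mem_maximalIdeal w).mpr fun hu ↦ hcon j w hu hw
        rw [ht, Ideal.mem_span_singleton] at hwm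
        obtain ⟨v, rfl⟩ := hwm
        exact ⟨v, by rw [hw]; ring⟩
    exact hz (zero_dvd_iff.mp (hn ▸ hdvd n))
  have hex : ∃ i, t ^ i ∈ I := ⟨n, hn ▸ I.zero_mem⟩
  let i := Nat.find hex
  have hi : t ^ i ∈ I := Nat.find_spec hex
  have hin : i ≤ n := Nat.find_min' hex (hn ▸ I.zero_mem)
  -- With `i` the least exponent such that t^i ∈ I, this puts t^(n-i) into 0 : I. A nonzero z = t^j
  -- w, `w` a unit, killed by it has j ≥ i because `n` is the least exponent with t^n = 0.
  have hIi : ∀ z ∈ I, t ^ (n - i) * z = 0 := by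
    intro z hz
    by_cases hz0 : z = 0
    · rw [hz0, mul_zero]
    · obtain ⟨j, w, hw, rfl⟩ := key z hz0
      have hij : i ≤ j := Nat.find_min' hex ((I.mul_unit_mem_iff_mem hw).mp hz)
      rw [← mul_assoc, ← pow_add, show n - i + j = n + (j - i) by omega, pow_add, hn]
      ring
  intro z hz
  by_cases hz0 : z = 0
  · exact hz0 ▸ I.zero_mem
  · obtain ⟨j, w, hw, rfl⟩ := key z hz0
    have h0 : t ^ j * w * t ^ (n - i) = 0 := by
      refine Submodule.mem_colon.mp hz _ (Submodule.mem_colon.mpr fun s hs ↦ ?_)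
      exact hIi s hs
    have h1 : t ^ (j + (n - i)) = 0 := by
      refine hw.mul_left_eq_zero.mp ?_
      rw [pow_add, ← h0]
      ring
    have h2 := hn' _ h1
    have hij : i ≤ j := by omega
    obtain ⟨l, rfl⟩ := Nat.exists_eq_add_of_le hij
    rw [pow_add, mul_assoc]
    exact I.mul_mem_right _ hi

/-- The module statement for M = R and a = (x), where the factor I((x) : (x)) lies in I. -/
lemma maximalIdeal_mul_colon_colon_le [IsNoetherianRing R] (hR : IsMCM R R) {d : ℕ} {x : Fin d → R}
    (hx : IsSystemOfParameters x)
    (hK : ∀ J ∈ avoidedIdeals R, ¬ Ideal.span (Set.range x) ≤ J) (I : Ideal R) :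
    maximalIdeal R *
        (Ideal.span (Set.range x)).colon ((Ideal.span (Set.range x)).colon (I : Set R) : Set R) ≤
      Ideal.span (Set.range x) ⊔ I := by
  refine Ideal.mul_le.mpr fun c hc z hz ↦ ?_
  have htop : Ideal.span (Set.range x) • (⊤ : Submodule R R) = Ideal.span (Set.range x) := by
    rw [smul_eq_mul, Ideal.mul_top]
  have h := smul_mem_of_mem_moduleColon hR hx hK hR (I := I) (m := z) le_rfl (fun r hr ↦ ?_) hc
  · rw [htop] at h
    exact sup_le_sup_left (Ideal.mul_le_left (I := I)) (Ideal.span (Set.range x)) h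
  · rw [htop, smul_eq_mul, mul_comm]
    exact Submodule.mem_colon.mp hz r hr

end CountableType

end AlmostGorenstein

theorem corollary3p3 {R : Type u} [CommRing R] [IsLocalRing R] [IsNoetherianRing R]
    (hCM : IsMCM R R) (htype : HasCountableCMType R)
    (hk : Uncountable (IsLocalRing.ResidueField R)) :
    -- the double colon inclusion for general systems of parameters
    (∀ (d : ℕ) (x : Fin d → R), IsGeneralSOP x → ∀ I : Ideal R,
      IsLocalRing.maximalIdeal R *
          (Ideal.span (Set.range x)).colon ((Ideal.span (Set.range x)).colon (I : Set R) : Set R) ≤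
        Ideal.span (Set.range x) ⊔ I) ∧
    -- the version with coefficients in a maximal Cohen-Macaulay module
    (∀ (d : ℕ) (x : Fin d → R), IsGeneralSOP x →
      ∀ (M : Type u) [AddCommGroup M] [Module R M], IsMCM R M →
      ∀ a I : Ideal R, Ideal.span (Set.range x) ≤ a → a ≤ I →
      ∀ xM A B : Submodule R M,
        xM = Ideal.span (Set.range x) • (⊤ : Submodule R M) →
        A = moduleColon xM (a.colon (I : Set R)) →
        B = xM ⊔ I • moduleColon xM a →
        B ≤ A ∧ IsLocalRing.maximalIdeal R ≤ Module.annihilator R (A ⧸ B.submoduleOf A)) ∧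
    -- general systems of parameters exist in positive dimension
    (ringKrullDim R ≠ 0 → ∃ (d : ℕ) (x : Fin d → R), IsGeneralSOP x) ∧
    -- the ideals to be avoided are countably many and properly contained in the maximal ideal,
    -- and every parameter ideal `K` that lies in none of them satisfies `K : (K : I) ⊆ I : m` for
    -- all `I ⊇ K`; in dimension zero there is no condition on `K`
    ((avoidedIdeals R).Countable ∧
      (∀ J ∈ avoidedIdeals R, J < IsLocalRing.maximalIdeal R) ∧
      ∀ (d : ℕ) (x : Fin d → R) (K : Ideal R), IsSystemOfParameters x →
        K = Ideal.span (Set.range x) →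
        (ringKrullDim R = 0 ∨ ∀ J ∈ avoidedIdeals R, ¬ K ≤ J) →
        ∀ I : Ideal R, K ≤ I →
          K.colon (K.colon (I : Set R) : Set R) ≤
            I.colon (IsLocalRing.maximalIdeal R : Set R)) := by
  have hgen : ∀ (d : ℕ) (x : Fin d → R), IsGeneralSOP x →
      ∀ J ∈ avoidedIdeals R, ¬ Ideal.span (Set.range x) ≤ J :=
    fun d x ⟨_, y, hy, hgen⟩ J hJ hle ↦ hgen J hJ (hle hy)
  refine ⟨fun d x hx I ↦ maximalIdeal_mul_colon_colon_le hCM hx.1 (hgen d x hx) I, ?_,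
    exists_isGeneralSOP htype, countable_avoidedIdeals htype,
    fun J ↦ lt_maximalIdeal_of_mem_avoidedIdeals, ?_⟩
  · rintro d x hx M _ _ hM a I hxa - xM A B rfl rfl rfl
    refine ⟨sup_le (fun m hm r _ ↦ Submodule.smul_mem _ r hm) (Submodule.smul_le.mpr ?_), ?_⟩
    -- For r in a : I and s in I the product rs lies in a, hence carries xM : a into xM.
    · intro s hs m hm r hr
      rw [smul_smul]
      exact hm _ (Submodule.mem_colon.mp hr s hs)
    · refine fun c hc ↦ Module.mem_annihilator.mpr fun q ↦ ?_
      obtain ⟨m, rfl⟩ := Submodule.mkQ_surjective _ q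
      exact (Submodule.Quotient.mk_eq_zero _).mpr
        (smul_mem_of_mem_moduleColon hCM hx.1 (hgen d x hx) hM hxa m.2 hc)
  · rintro d x K hx rfl hK I hKI z hz
    refine Submodule.mem_colon.mpr fun c hc ↦ ?_
    -- In dimension zero K = 0 lies in every avoided ideal, so the Ext argument is replaced by the
    -- double annihilator property.
    rcases hK with hdim | hK
    · obtain ⟨t, ht⟩ := exists_maximalIdeal_eq_span_singleton htype hdim
      have := ringKrullDimZero_iff_ringKrullDim_eq_zero.mpr hdim
      have hnil : IsNilpotent t := Ring.KrullDimLE.isNilpotent_iff_mem_maximalIdeal.mpr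
        (ht ▸ Ideal.mem_span_singleton_self t)
      obtain rfl : d = 0 := by
        have := hx.1.symm.trans hdim
        exact_mod_cast this
      have hbot : Ideal.span (Set.range x) = ⊥ := by
        rw [Set.range_eq_empty x, Ideal.span_empty]
      rw [hbot] at hz
      exact I.mul_mem_right _ (bot_colon_bot_colon_le ht hnil I hz)
    · have h := maximalIdeal_mul_colon_colon_le hCM hx hK I (Ideal.mul_mem_mul hc hz)
      rw [sup_eq_right.mpr hKI] at h
      rw [smul_eq_mul, mul_comm]
      exact h
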